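/- **Theorem (one-posterior-sampling with generalized PTR).** Let $\mathcal X\subset\mathbb R^d$ and $\mathcal Y\subset\mathbb R$ be bounded, $\|\mathcal X\|=\sup_{x\in\mathcal X}\|x\|$, $\|\mathcal Y\|=\sup_{y\in\mathcal Y}|y|$. A data set $Z=(X,Y)$ consists of $n$ points $(x_i,y_i)\in\mathcal X\times\mathcal Y$ (the $x_i$ are the rows of $X$); two data sets are neighbors if they differ in at most one of the $n$ points. A randomized algorithm $M$ is $(\epsilon,\delta)$-DP if $\Pr[M(Z)\in S]\le e^{\epsilon}\Pr[M(Z')\in S]+\delta$ for all neighbors $Z,Z'$ and measurable $S$; it is $(\epsilon,\delta)$ data-dependent DP for the data set $Z$ if this inequality and the one with $Z,Z'$ exchanged hold for all neighbors $Z'$ of $Z$ and all measurable $S$. Fix $\lambda,\gamma>0$, $\epsilon,\delta,\hat\epsilon\ge 0$ and $\hat\delta>0$. Let $M_{\lambda,\gamma}(Z)$ be a sample from the probability density on $\mathbb R^d$ proportional to $$\exp\!\big(-\gamma\,(\tfrac12\|Y-X\theta\|^2+\tfrac12\lambda\|\theta\|^2)\big).$$ Let $\lambda_{\min}(Z)$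 be the smallest eigenvalue of $X^TX$, $\theta^*_\lambda=(X^TX+\lambda I)^{-1}X^TY$, and $L(Z)=\|\mathcal X\|(\|\mathcal X\|\|\theta^*_\lambda\|+\|\mathcal Y\|)$. Let $R$ be an $(\epsilon,\delta/2)$-DP mechanism with outputs in $\mathbb R^3$ (the private release of $\lambda_{\min},\|\theta^*_\lambda\|,L$), and let $\epsilon^P:\mathbb R^3\to\mathbb R$ be measurable (the sanitized data-dependent DP bound). The algorithm *OPS with PTR* draws $r\sim R(Z)$ and publishes it; if $\epsilon^P(r)<\hat\epsilon$ it publishes $\theta\sim M_{\lambda,\gamma}(Z)$, otherwise it publishes $\perp$. 1. Let $e:\mathbb R^3\to\mathbb R$ be any function such that, with $\epsilon_\phi(Z):=e(\lambda_{\min}(Z),\|\theta_\lambda^*\|,L(Z))$, $M_{\lambda,\gamma}$ is $(\epsilon_\phi(Z),\hat\delta)$ data-dependent DP for every data set $Z$. If for every $Z$, with probability at least $1-\delta/2$ over $r\sim R(Z)$, $\epsilon_\phi(Z)\le\epsilon^P(r)$, then OPS with PTR is $(\epsilon+\hat\epsilon,\delta+\hat\delta)$-DP. 2. In particular, let $c=(\underline\lambda,\overline\theta,\overline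 L):\mathbb R^3\to\mathbb R^3$ be a measurable map such that for every $Z$, with probability at least $1-\delta/2$ over $r\sim R(Z)$, the three bounds $\underline\lambda(r)\le\lambda_{\min}(Z)$, $\|\theta^*_\lambda\|\le\overline\theta(r)$ and $L(Z)\le\overline L(r)$ hold. Then OPS with PTR with the explicit test $$\epsilon^P(r)=a^2+at+\tfrac b2\big(1+(a+t)^2\big),\qquad a=2\overline L(r)\sqrt{\gamma/\kappa},\quad b=\|\mathcal X\|^2/\kappa,\quad t=\sqrt{2\log(3/\hat\delta)},$$ $$\kappa=\lambda+\max(\underline\lambda(r)-\|\mathcal X\|^2,0),$$ (where $t:=0$ if $\hat\delta>3$) is $(\epsilon+\hat\epsilon,\delta+\hat\delta)$-DP. -/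

import Mathlib

open MeasureTheory
open scoped Matrix ENNReal

noncomputable section

namespace OPSPTR

/-- Data sets of size `n`: each data point is a pair of a covariate in `𝒳 ⊆ ℝ^d` and a response
in `𝒴 ⊆ ℝ`. -/
abbrev Dataset {d : ℕ} (𝒳 : Set (EuclideanSpace ℝ (Fin d))) (𝒴 : Set ℝ) (n : ℕ) : Type :=
  Fin n → 𝒳 × 𝒴

open Classical in
/-- Two data sets of the same size are neighbors if they differ in at most one data point. -/
def Neighbor {A : Type*} {n : ℕ} (z z' : Fin n → A) : Prop :=
  hammingDist z z' ≤ 1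

/-- `(ε, δ)`-differential privacy of a randomized algorithm; `M z` is the law of its output
on the data set `z`. -/
structure IsDP {A Ω : Type*} {n : ℕ} [MeasurableSpace Ω]
    (M : (Fin n → A) → Measure Ω) (ε δ : ℝ) : Prop where
  isProbabilityMeasure : ∀ z, IsProbabilityMeasure (M z)
  bound : ∀ z z', Neighbor z z' → ∀ S : Set Ω, MeasurableSet S →
    M z S ≤ ENNReal.ofReal (Real.exp ε) * M z' S + ENNReal.ofReal δ

/-- `M` satisfies `(ε, δ)` data-dependent differential privacy for the data set `z`. -/
def IsDataDependentDP {A Ω : Type*} {n : ℕ} [MeasurableSpace Ω]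
    (M : (Fin n → A) → Measure Ω) (z : Fin n → A) (ε δ : ℝ) : Prop :=
  ∀ z', Neighbor z z' → ∀ S : Set Ω, MeasurableSet S →
    M z S ≤ ENNReal.ofReal (Real.exp ε) * M z' S + ENNReal.ofReal δ ∧
    M z' S ≤ ENNReal.ofReal (Real.exp ε) * M z S + ENNReal.ofReal δ

/-- `sup_{x ∈ A} ‖x‖`. -/
def radius {E : Type*} [Norm E] (A : Set E) : ℝ :=
  sSup ((fun x => ‖x‖) '' A)

section Regression

variable {d n : ℕ} {𝒳 : Set (EuclideanSpace ℝ (Fin d))} {𝒴 : Set ℝ}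

/-- The `n × d` matrix `X` whose rows are the covariates. -/
def design (z : Dataset 𝒳 𝒴 n) : Matrix (Fin n) (Fin d) ℝ :=
  Matrix.of fun i j => ((z i).1 : EuclideanSpace ℝ (Fin d)) j

/-- The vector `Y` of responses. -/
def response (z : Dataset 𝒳 𝒴 n) : Fin n → ℝ :=
  fun i => ((z i).2 : ℝ)

/-- The smallest eigenvalue of `Xᵀ X`. -/
def lambdaMin (z : Dataset 𝒳 𝒴 n) : ℝ :=
  sInf (spectrum ℝ ((design z)ᵀ * design z))

/-- The ridge regression solution `(Xᵀ X + lam I)⁻¹ Xᵀ Y`. -/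
def ridge (lam : ℝ) (z : Dataset 𝒳 𝒴 n) : EuclideanSpace ℝ (Fin d) :=
  WithLp.toLp 2
    (((design z)ᵀ * design z + lam • (1 : Matrix (Fin d) (Fin d) ℝ))⁻¹ *ᵥ
      ((design z)ᵀ *ᵥ response z))

/-- The local Lipschitz constant `‖𝒳‖ (‖𝒳‖ ‖θ‖ + ‖𝒴‖)` at the ridge solution `θ`. -/
def localLipschitz (lam : ℝ) (z : Dataset 𝒳 𝒴 n) : ℝ :=
  radius 𝒳 * (radius 𝒳 * ‖ridge lam z‖ + radius 𝒴)

/-- The regression loss `½ ‖Y - X θ‖²`. -/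
def loss (z : Dataset 𝒳 𝒴 n) (θ : EuclideanSpace ℝ (Fin d)) : ℝ :=
  (1 / 2) * ∑ i, (response z i - (design z *ᵥ θ.ofLp) i) ^ 2

/-- One posterior sample: the probability measure on `ℝ^d` with Lebesgue density proportional to
`exp (-gam (½ ‖Y - X θ‖² + ½ lam ‖θ‖²))`. -/
def posterior (lam gam : ℝ) (z : Dataset 𝒳 𝒴 n) : Measure (EuclideanSpace ℝ (Fin d)) :=
  (volume : Measure (EuclideanSpace ℝ (Fin d))).tilted
    fun θ => -gam * (loss z θ + (1 / 2) * lam * ‖θ‖ ^ 2)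

open Classical in
/-- One posterior sampling with generalized propose-test-release, for the proposal `(lam, gam)`.
Draw `r` from the release mechanism `R` (sanitized values of `λ_min`, `‖θ‖` and `L`), publish it,
and compute the sanitized privacy bound `epsP r`. If it is smaller than the budget `epsHat`, publish
a sample from the posterior; otherwise publish `⊥`, represented by `Sum.inr ()`. -/
def opsPTR (lam gam : ℝ) (R : Dataset 𝒳 𝒴 n → Measure (ℝ × ℝ × ℝ)) (epsP : ℝ × ℝ × ℝ → ℝ)
    (epsHat : ℝ) (z : Dataset 𝒳 𝒴 n) :
    Measure ((ℝ × ℝ × ℝ) × (EuclideanSpace ℝ (Fin d) ⊕ Unit)) :=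
  (R z).bind fun r =>
    if epsP r < epsHat then (posterior lam gam z).map fun θ => (r, Sum.inl θ)
    else Measure.dirac (r, Sum.inr ())

end Regression

/-- An explicit privacy bound for posterior sampling, as a function of the smallest eigenvalue
`l` and the local Lipschitz constant `L`; here `B = ‖𝒳‖` and `δ` is the failure probability. With
`κ = lam + max (l - B², 0)`, `a = 2 L √(gam / κ)`, `b = B² / κ` and `t = √(2 log (3 / δ))` it is
`a² + a t + (b / 2) (1 + (a + t)²)`. -/
def explicitBound (lam gam B δ l L : ℝ) : ℝ :=
  let κ := lam + max (l - B ^ 2) 0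
  let a := 2 * L * Real.sqrt (gam / κ)
  let b := B ^ 2 / κ
  let t := Real.sqrt (2 * Real.log (3 / δ))
  a ^ 2 + a * t + b / 2 * (1 + (a + t) ^ 2)

end OPSPTR

end

/-! Completing the square, the posterior is Gaussian with precision `gam (XᵀX + lam I)` and mean the
ridge solution. For neighbors differing at point `i`, both precisions are a common operator `S` plus
a rank one term. Deleting `x_i` costs at most `‖𝒳‖²` of `λ_min`, so `S` has coercivity constant `gam
κ`.

The log-likelihood ratio has four kinds of terms. The ratio of the normalizing constants contributes
at most `b / 2`, by a Jensen-type bound (`gaussianMass_le_add_rankOneSq`). The mean shift `w`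
satisfies `T' w = g`, where `g` is `gam` times a difference of two one-point residual terms at the
ridge solution of `z`. Hence `‖g‖ ≤ 2 gam L(z)` and `⟪g, w⟫ ≤ a²`. What remains is linear in `⟪g,
·⟫` and quadratic in `⟪x, ·⟫` or `⟪x', ·⟫`, controlled by Chernoff bounds off an event of
probability `3 exp (-t² / 2) = δ`. This gives `posterior_isDataDependentDP`.

For the release, the test reads only `r`, so neighbors take the same branch. On the event that `epsP
r` dominates the true bound, a passed test certifies `εhat`, and a failed one publishes `⊥` for
both. `bind_le_of_kernel_le` composes this with the privacy of `R`; the `δ / 2` of `R` and the `δ /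
2` of the bad event add up to `δ`. -/

noncomputable section

namespace OPSPTR

/-! ### Gaussian integrals, tail bounds, and closeness of two Gaussians -/

section Gaussian

open scoped RealInnerProductSpace

variable {V : Type*} [NormedAddCommGroup V] [InnerProductSpace ℝ V]

/-- A symmetric operator whose quadratic form dominates `κ ‖u‖²`. -/
structure IsCoerciveSymm (κ : ℝ) (T : V →L[ℝ] V) : Prop where
  symm : ∀ u v, ⟪T u, v⟫ = ⟪u, T v⟫
  bound : ∀ u, κ * ‖u‖ ^ 2 ≤ ⟪T u, u⟫

/-- The rank one operator `u ↦ ⟪x, u⟫ x`. -/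
def rankOneSq (x : V) : V →L[ℝ] V := (innerSL ℝ x).smulRight x

@[simp]
lemma rankOneSq_apply (x u : V) : rankOneSq x u = ⟪x, u⟫ • x := by
  simp [rankOneSq]

lemma inner_rankOneSq_self (x u : V) : ⟪rankOneSq x u, u⟫ = ⟪x, u⟫ ^ 2 := by
  simp [real_inner_smul_left, sq]

lemma IsCoerciveSymm.add_rankOneSq {κ : ℝ} {T : V →L[ℝ] V} (hT : IsCoerciveSymm κ T) (x : V) :
    IsCoerciveSymm κ (T + rankOneSq x) where
  symm u v := by
    simp [inner_add_left, inner_add_right, real_inner_smul_left, real_inner_smul_right, hT.symm,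
      real_inner_comm x u, mul_comm]
  bound u := by
    rw [add_apply, inner_add_left, inner_rankOneSq_self]
    linarith [hT.bound u, sq_nonneg ⟪x, u⟫]

/-- Cauchy–Schwarz against coercivity. This plays the role of `T⁻¹ ≤ κ⁻¹`, with `w` standing for the
preimage of a vector under `T`. -/
lemma IsCoerciveSymm.inner_le {κ : ℝ} (hκ : 0 < κ) {T : V →L[ℝ] V} (hT : IsCoerciveSymm κ T)
    (w : V) : ⟪T w, w⟫ ≤ ‖T w‖ ^ 2 / κ ∧ κ * ‖w‖ ≤ ‖T w‖ := by
  have h1 := hT.bound w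
  have h2 := real_inner_le_norm (T w) w
  have h3 : κ * ‖w‖ ≤ ‖T w‖ := by
    rcases (norm_nonneg w).eq_or_lt with h | h
    · rw [← h]; simp
    · refine le_of_mul_le_mul_right ?_ h
      nlinarith
  refine ⟨?_, h3⟩
  rw [le_div_iff₀ hκ]
  nlinarith [norm_nonneg (T w)]

variable [FiniteDimensional ℝ V]

/-- Coercivity gives injectivity, hence surjectivity in finite dimension. It supplies the center `w`
when completing the square. -/
lemma IsCoerciveSymm.surjective {κ : ℝ} (hκ : 0 < κ) {T : V →L[ℝ] V} (hT : IsCoerciveSymm κ T) :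
    Function.Surjective T := by
  have hinj : Function.Injective (T : V →ₗ[ℝ] V) := by
    rw [← LinearMap.ker_eq_bot, LinearMap.ker_eq_bot']
    intro u hu
    have h0 : T u = 0 := hu
    have := (hT.inner_le hκ u).2
    rw [h0, norm_zero] at this
    exact norm_le_zero_iff.1 (nonpos_of_mul_nonpos_right this hκ)
  exact LinearMap.injective_iff_surjective.1 hinj

variable [MeasurableSpace V] [BorelSpace V]

lemma integrable_exp_inner_sub_quadratic {κ : ℝ} (hκ : 0 < κ) {T : V →L[ℝ] V}
    (hT : IsCoerciveSymm κ T) (c : V) :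
    Integrable (fun u : V => Real.exp (⟪c, u⟫ - 1 / 2 * ⟪T u, u⟫)) := by
  have h := (GaussianFourier.integrable_cexp_neg_mul_sq_norm_add (V := V) (b := ((κ / 2 : ℝ) : ℂ))
    (by simpa using hκ) 1 c).norm
  refine h.mono' (by fun_prop) (ae_of_all _ fun u => ?_)
  rw [Complex.norm_exp, Real.norm_eq_abs, Real.abs_exp]
  refine Real.exp_le_exp.2 ?_
  have h1 : (-((κ / 2 : ℝ) : ℂ) * (‖u‖ : ℂ) ^ 2 + 1 * ((⟪c, u⟫ : ℝ) : ℂ)).re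
      = -(κ / 2) * ‖u‖ ^ 2 + ⟪c, u⟫ := by
    rw [one_mul, ← Complex.ofReal_neg, ← Complex.ofReal_pow, ← Complex.ofReal_mul,
      ← Complex.ofReal_add, Complex.ofReal_re]
  refine le_trans ?_ h1.ge
  linarith [hT.bound u]

lemma integrable_exp_neg_quadratic {κ : ℝ} (hκ : 0 < κ) {T : V →L[ℝ] V}
    (hT : IsCoerciveSymm κ T) :
    Integrable (fun u : V => Real.exp (-(1 / 2) * ⟪T u, u⟫)) := by
  convert integrable_exp_inner_sub_quadratic hκ hT 0 using 3
  simp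

/-- The Gaussian integral `∫ exp (-⟪T u, u⟫ / 2) du`. -/
def gaussianMass (T : V →L[ℝ] V) : ℝ := ∫ u : V, Real.exp (-(1 / 2) * ⟪T u, u⟫)

lemma gaussianMass_pos {κ : ℝ} (hκ : 0 < κ) {T : V →L[ℝ] V} (hT : IsCoerciveSymm κ T) :
    0 < gaussianMass T :=
  integral_exp_pos (integrable_exp_neg_quadratic hκ hT)

/-- Writing `c = T w`, completing the square and translating by `w` leave the factor `exp (⟪T w, w⟫
/ 2)`. -/
lemma integral_exp_inner_sub_quadratic_le {κ : ℝ} (hκ : 0 < κ) {T : V →L[ℝ] V}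
    (hT : IsCoerciveSymm κ T) (c : V) :
    ∫ u : V, Real.exp (⟪c, u⟫ - 1 / 2 * ⟪T u, u⟫)
      ≤ Real.exp (‖c‖ ^ 2 / κ / 2) * gaussianMass T := by
  obtain ⟨w, rfl⟩ := hT.surjective hκ c
  have key : ∀ u : V, Real.exp (⟪T w, u⟫ - 1 / 2 * ⟪T u, u⟫)
      = Real.exp (1 / 2 * ⟪T w, w⟫) * Real.exp (-(1 / 2) * ⟪T (u - w), u - w⟫) := by
    intro u
    rw [← Real.exp_add]
    congr 1
    simp only [map_sub, inner_sub_left, inner_sub_right]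
    rw [hT.symm u w, real_inner_comm (T w) u]
    ring
  simp_rw [key]
  rw [integral_const_mul, integral_sub_right_eq_self
    (fun u : V => Real.exp (-(1 / 2) * ⟪T u, u⟫)) w]
  refine mul_le_mul_of_nonneg_right (Real.exp_le_exp.2 ?_) (gaussianMass_pos hκ hT).le
  linarith [(hT.inner_le hκ w).1]

lemma gaussianMass_add_rankOneSq_le {κ : ℝ} (hκ : 0 < κ) {T : V →L[ℝ] V}
    (hT : IsCoerciveSymm κ T) (x : V) : gaussianMass (T + rankOneSq x) ≤ gaussianMass T := by
  refine integral_mono (integrable_exp_neg_quadratic hκ (hT.add_rankOneSq x))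
    (integrable_exp_neg_quadratic hκ hT) fun u => Real.exp_le_exp.2 ?_
  rw [add_apply, inner_add_left, inner_rankOneSq_self]
  linarith [sq_nonneg ⟪x, u⟫]

/-- From `cosh y = 1 + 2 sinh² (y / 2)` and `y / 2 ≤ sinh (y / 2)` for `y ≥ 0`. -/
lemma one_add_sq_div_two_le_cosh (x : ℝ) : 1 + x ^ 2 / 2 ≤ Real.cosh x := by
  have h : ∀ y : ℝ, 0 ≤ y → 1 + y ^ 2 / 2 ≤ Real.cosh y := by
    intro y hy
    have h1 := Real.self_le_sinh_iff.2 (div_nonneg hy zero_le_two)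
    have h2 := Real.cosh_two_mul (y / 2)
    rw [Real.cosh_sq, show 2 * (y / 2) = y by ring] at h2
    nlinarith
  rw [← Real.cosh_abs, ← sq_abs]
  exact h _ (abs_nonneg x)

/-- The tangent line of `exp` at `-b / 2`, with `w²` replaced by the larger `2 (cosh (s w) - 1) /
s²`, whose Gaussian integral is controlled by exponential moments alone. -/
lemma exp_neg_sq_half_ge (b s w : ℝ) (hs : 0 < s) :
    Real.exp (-b / 2) * (1 + b / 2 + (1 - (Real.exp (s * w) + Real.exp (-(s * w))) / 2) / s ^ 2)
      ≤ Real.exp (-(w ^ 2) / 2) := by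
  have h1 : Real.exp (-(w ^ 2) / 2) = Real.exp (-b / 2) * Real.exp (b / 2 - w ^ 2 / 2) := by
    rw [← Real.exp_add]; congr 1; ring
  rw [h1]
  refine mul_le_mul_of_nonneg_left ?_ (Real.exp_pos _).le
  have h2 := Real.add_one_le_exp (b / 2 - w ^ 2 / 2)
  have h3 := one_add_sq_div_two_le_cosh (s * w)
  rw [Real.cosh_eq] at h3
  have h4 : (1 - (Real.exp (s * w) + Real.exp (-(s * w))) / 2) / s ^ 2 ≤ -(w ^ 2) / 2 := by
    rw [div_le_iff₀ (by positivity)]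
    nlinarith
  linarith

/-- Jensen's inequality: under the Gaussian with precision `T`, the mean of `exp (-⟪x, u⟫² / 2)` is
at least `exp (-b / 2)`, as `⟪x, u⟫` has variance at most `b`. The variance is approached through
`cosh (s ⟪x, u⟫)` as `s → 0`. -/
lemma gaussianMass_le_add_rankOneSq {κ b : ℝ} (hκ : 0 < κ) {T : V →L[ℝ] V}
    (hT : IsCoerciveSymm κ T) {x : V} (hx : ‖x‖ ^ 2 ≤ b * κ) :
    gaussianMass T ≤ Real.exp (b / 2) * gaussianMass (T + rankOneSq x) := by
  have hb : 0 ≤ b := nonneg_of_mul_nonneg_left ((sq_nonneg _).trans hx) hκ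
  have hZ := gaussianMass_pos hκ hT
  set Z := gaussianMass T
  have step : ∀ s : ℝ, 0 < s →
      Real.exp (-b / 2) * (Z * (1 + b / 2 + (1 - Real.exp (s ^ 2 * b / 2)) / s ^ 2))
        ≤ gaussianMass (T + rankOneSq x) := by
    intro s hs
    -- Only `c = ±1` is used: the two exponentials of `cosh`.
    have hi : ∀ c : ℝ, ∫ u : V, Real.exp (⟪(c * s) • x, u⟫ - 1 / 2 * ⟪T u, u⟫)
        ≤ Real.exp (‖(c * s) • x‖ ^ 2 / κ / 2) * Z := fun c =>
      integral_exp_inner_sub_quadratic_le hκ hT _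
    have hn : ∀ c : ℝ, c ^ 2 = 1 → Real.exp (‖(c * s) • x‖ ^ 2 / κ / 2)
        ≤ Real.exp (s ^ 2 * b / 2) := by
      intro c hc
      refine Real.exp_le_exp.2 ?_
      rw [norm_smul, mul_pow, Real.norm_eq_abs, sq_abs, mul_pow, hc, one_mul]
      have : s ^ 2 * ‖x‖ ^ 2 / κ ≤ s ^ 2 * b := by
        rw [div_le_iff₀ hκ]
        nlinarith [sq_nonneg s]
      linarith
    have i1 := integrable_exp_inner_sub_quadratic hκ hT ((1 * s) • x)
    have i2 := integrable_exp_inner_sub_quadratic hκ hT ((-1 * s) • x)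
    have i0 := integrable_exp_neg_quadratic hκ hT
    have e1 := (hi 1).trans (mul_le_mul_of_nonneg_right (hn 1 (by norm_num)) hZ.le)
    have e2 := (hi (-1)).trans (mul_le_mul_of_nonneg_right (hn (-1) (by norm_num)) hZ.le)
    have hmono : ∫ u : V, Real.exp (-b / 2) * ((1 + b / 2 + 1 / s ^ 2) *
          Real.exp (-(1 / 2) * ⟪T u, u⟫)
        - (1 / (2 * s ^ 2)) * (Real.exp (⟪(1 * s) • x, u⟫ - 1 / 2 * ⟪T u, u⟫)
          + Real.exp (⟪(-1 * s) • x, u⟫ - 1 / 2 * ⟪T u, u⟫)))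
        ≤ gaussianMass (T + rankOneSq x) := by
      refine integral_mono (((i0.const_mul _).sub ((i1.add i2).const_mul _)).const_mul _)
        (integrable_exp_neg_quadratic hκ (hT.add_rankOneSq x)) fun u => ?_
      have h := mul_le_mul_of_nonneg_right (exp_neg_sq_half_ge b s ⟪x, u⟫ hs)
        (Real.exp_pos (-(1 / 2) * ⟪T u, u⟫)).le
      have ea : Real.exp (⟪(1 * s) • x, u⟫ - 1 / 2 * ⟪T u, u⟫)
          = Real.exp (s * ⟪x, u⟫) * Real.exp (-(1 / 2) * ⟪T u, u⟫) := by
        rw [← Real.exp_add, real_inner_smul_left]; congr 1; ring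
      have eb : Real.exp (⟪(-1 * s) • x, u⟫ - 1 / 2 * ⟪T u, u⟫)
          = Real.exp (-(s * ⟪x, u⟫)) * Real.exp (-(1 / 2) * ⟪T u, u⟫) := by
        rw [← Real.exp_add, real_inner_smul_left]; congr 1; ring
      have ec : Real.exp (-(1 / 2) * ⟪(T + rankOneSq x) u, u⟫)
          = Real.exp (-(⟪x, u⟫ ^ 2) / 2) * Real.exp (-(1 / 2) * ⟪T u, u⟫) := by
        rw [← Real.exp_add, add_apply, inner_add_left, inner_rankOneSq_self]
        congr 1; ring
      dsimp only
      rw [ea, eb, ec]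
      refine le_trans (le_of_eq ?_) h
      field_simp
      ring
    have hi12 : Integrable (fun u : V => Real.exp (⟪(1 * s) • x, u⟫ - 1 / 2 * ⟪T u, u⟫)
        + Real.exp (⟪(-1 * s) • x, u⟫ - 1 / 2 * ⟪T u, u⟫)) := i1.add i2
    rw [integral_const_mul, integral_sub (i0.const_mul _) (hi12.const_mul _),
      integral_const_mul, integral_const_mul, integral_add i1 i2] at hmono
    refine le_trans (mul_le_mul_of_nonneg_left ?_ (Real.exp_pos _).le) hmono
    change _ ≤ _ * Z - _
    have : (1 / (2 * s ^ 2)) * ((∫ u : V, Real.exp (⟪(1 * s) • x, u⟫ - 1 / 2 * ⟪T u, u⟫))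
        + ∫ u : V, Real.exp (⟪(-1 * s) • x, u⟫ - 1 / 2 * ⟪T u, u⟫))
        ≤ (1 / (2 * s ^ 2)) * (2 * (Real.exp (s ^ 2 * b / 2) * Z)) :=
      mul_le_mul_of_nonneg_left (by linarith) (by positivity)
    refine le_trans (le_of_eq ?_) (sub_le_sub_left this _)
    field_simp
    ring
  -- Here `τ = s²`; the quadratic remainder `(τ b / 2)²` of `exp`, divided by `τ`, gives the error
  -- `τ b² / 4`.
  have small : ∀ τ : ℝ, 0 < τ → τ * b / 2 ≤ 1 →
      Z * (1 - τ * b ^ 2 / 4) ≤ Real.exp (b / 2) * gaussianMass (T + rankOneSq x) := by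
    intro τ hτ hτb
    have h := step (Real.sqrt τ) (Real.sqrt_pos.2 hτ)
    rw [Real.sq_sqrt hτ.le] at h
    have h1 := Real.abs_exp_sub_one_sub_id_le (x := τ * b / 2)
      (by rw [abs_of_nonneg (by positivity)]; exact hτb)
    have h2 := (abs_le.1 h1).2
    have h3 : -(b / 2) - τ * b ^ 2 / 4 ≤ (1 - Real.exp (τ * b / 2)) / τ := by
      rw [le_div_iff₀ hτ]; nlinarith
    have h4 := mul_le_mul_of_nonneg_left h (Real.exp_pos (b / 2)).le
    rw [← mul_assoc, ← Real.exp_add, show b / 2 + -b / 2 = 0 by ring, Real.exp_zero, one_mul] at h4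
    refine le_trans (mul_le_mul_of_nonneg_left ?_ hZ.le) h4
    linarith
  have lim : Filter.Tendsto (fun τ : ℝ => Z * (1 - τ * b ^ 2 / 4)) (nhdsWithin 0 (Set.Ioi 0))
      (nhds Z) := by
    have : Filter.Tendsto (fun τ : ℝ => Z * (1 - τ * b ^ 2 / 4)) (nhds 0)
        (nhds (Z * (1 - 0 * b ^ 2 / 4))) := Continuous.tendsto (by fun_prop) 0
    simpa using this.mono_left nhdsWithin_le_nhds
  refine le_of_tendsto lim ?_
  have hτ : ∀ᶠ τ : ℝ in nhdsWithin 0 (Set.Ioi 0), τ * b / 2 < 1 := by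
    have : Filter.Tendsto (fun τ : ℝ => τ * b / 2) (nhds 0) (nhds (0 * b / 2)) :=
      Continuous.tendsto (by fun_prop) 0
    exact (this.mono_left nhdsWithin_le_nhds).eventually (gt_mem_nhds (by simp))
  filter_upwards [hτ, self_mem_nhdsWithin] with τ h1 h2 using small τ h2 h1.le

/-- The Gaussian measure with mean `m` and precision operator `T`. -/
def gaussianOf (T : V →L[ℝ] V) (m : V) : Measure V :=
  (volume : Measure V).tilted fun θ => -(1 / 2) * ⟪T (θ - m), θ - m⟫

lemma integrable_exp_neg_quadratic_sub {κ : ℝ} (hκ : 0 < κ) {T : V →L[ℝ] V}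
    (hT : IsCoerciveSymm κ T) (m : V) :
    Integrable (fun θ : V => Real.exp (-(1 / 2) * ⟪T (θ - m), θ - m⟫)) :=
  (integrable_exp_neg_quadratic hκ hT).comp_sub_right m

lemma integral_exp_neg_quadratic_sub (T : V →L[ℝ] V) (m : V) :
    ∫ θ : V, Real.exp (-(1 / 2) * ⟪T (θ - m), θ - m⟫) = gaussianMass T :=
  integral_sub_right_eq_self (fun u : V => Real.exp (-(1 / 2) * ⟪T u, u⟫)) m

lemma isProbabilityMeasure_gaussianOf {κ : ℝ} (hκ : 0 < κ) {T : V →L[ℝ] V}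
    (hT : IsCoerciveSymm κ T) (m : V) : IsProbabilityMeasure (gaussianOf T m) :=
  isProbabilityMeasure_tilted (integrable_exp_neg_quadratic_sub hκ hT m)

lemma lintegral_exp_inner_gaussianOf_le {κ : ℝ} (hκ : 0 < κ) {T : V →L[ℝ] V}
    (hT : IsCoerciveSymm κ T) (m c : V) :
    ∫⁻ θ, ENNReal.ofReal (Real.exp ⟪c, θ - m⟫) ∂(gaussianOf T m)
      ≤ ENNReal.ofReal (Real.exp (‖c‖ ^ 2 / κ / 2)) := by
  have hZ := gaussianMass_pos hκ hT
  rw [gaussianOf, lintegral_tilted, integral_exp_neg_quadratic_sub]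
  have key : ∀ θ : V, ENNReal.ofReal (Real.exp (-(1 / 2) * ⟪T (θ - m), θ - m⟫) / gaussianMass T)
      * ENNReal.ofReal (Real.exp ⟪c, θ - m⟫)
      = ENNReal.ofReal (Real.exp (⟪c, θ - m⟫ - 1 / 2 * ⟪T (θ - m), θ - m⟫) / gaussianMass T) := by
    intro θ
    rw [← ENNReal.ofReal_mul (by positivity), div_mul_eq_mul_div, ← Real.exp_add]
    congr 3
    ring
  simp_rw [key]
  rw [lintegral_sub_right_eq_self (fun u : V =>
    ENNReal.ofReal (Real.exp (⟪c, u⟫ - 1 / 2 * ⟪T u, u⟫) / gaussianMass T)) m,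
    ← ofReal_integral_eq_lintegral_ofReal
      ((integrable_exp_inner_sub_quadratic hκ hT c).div_const _)
      (ae_of_all _ fun u => by positivity), integral_div]
  refine ENNReal.ofReal_le_ofReal ?_
  rw [div_le_iff₀ hZ]
  exact integral_exp_inner_sub_quadratic_le hκ hT c

/-- Gaussian tail bound for linear functionals. -/
lemma gaussianOf_tail {κ σ t : ℝ} (hκ : 0 < κ) (hσ : 0 ≤ σ) (ht : 0 ≤ t) {T : V →L[ℝ] V}
    (hT : IsCoerciveSymm κ T) (m : V) {c : V} (hc : ‖c‖ ^ 2 ≤ σ ^ 2 * κ) :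
    gaussianOf T m {θ | σ * t < ⟪c, θ - m⟫} ≤ ENNReal.ofReal (Real.exp (-t ^ 2 / 2)) := by
  -- For `σ = 0` the Chernoff parameter `t / σ` is meaningless, but then `c = 0` and the event is
  -- empty.
  rcases hσ.eq_or_lt with rfl | hσ
  · have hc0 : c = 0 := by
      have : ‖c‖ ^ 2 ≤ 0 := by simpa using hc
      simpa using this
    simp [hc0]
  have hmeas : AEMeasurable (fun θ : V => ENNReal.ofReal (Real.exp ⟪(t / σ) • c, θ - m⟫))
      (gaussianOf T m) := by fun_prop
  have h1 := lintegral_exp_inner_gaussianOf_le hκ hT m ((t / σ) • c)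
  -- Markov at level `exp (t²)`, against an exponential moment of at most `exp (t² / 2)`.
  have h2 := meas_ge_le_lintegral_div hmeas (ε := ENNReal.ofReal (Real.exp (t ^ 2)))
    (by simp [Real.exp_pos]) ENNReal.ofReal_ne_top
  refine (measure_mono fun θ hθ => ?_).trans (h2.trans
    ((ENNReal.div_le_div_right h1 _).trans ?_))
  · refine ENNReal.ofReal_le_ofReal (Real.exp_le_exp.2 ?_)
    rw [real_inner_smul_left]
    have h3 : t / σ * (σ * t) ≤ t / σ * ⟪c, θ - m⟫ :=
      mul_le_mul_of_nonneg_left (le_of_lt hθ) (by positivity)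
    refine le_trans (le_of_eq ?_) h3
    field_simp
  · rw [← ENNReal.ofReal_div_of_pos (Real.exp_pos _), ← Real.exp_sub]
    refine ENNReal.ofReal_le_ofReal (Real.exp_le_exp.2 ?_)
    rw [norm_smul, mul_pow, Real.norm_eq_abs, sq_abs, div_pow]
    have h4 : t ^ 2 / σ ^ 2 * ‖c‖ ^ 2 / κ ≤ t ^ 2 := by
      rw [div_le_iff₀ hκ, div_mul_eq_mul_div, div_le_iff₀ (by positivity)]
      nlinarith [sq_nonneg t]
    linarith

/-- If the log-likelihood ratio of two tilted measures exceeds `ε` with probability at most `δ`,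
they are `(ε, δ)`-indistinguishable. -/
lemma tilted_le_of_tail {Ω : Type*} [MeasurableSpace Ω] {μ : Measure Ω} {f g : Ω → ℝ}
    (hf : Measurable f) (hg : Measurable g) {ε : ℝ} {δ : ℝ≥0∞}
    (hfi : 0 < ∫ x, Real.exp (f x) ∂μ) (hgi : 0 < ∫ x, Real.exp (g x) ∂μ)
    (htail : μ.tilted f {x | ε < f x - g x + Real.log (∫ x, Real.exp (g x) ∂μ)
      - Real.log (∫ x, Real.exp (f x) ∂μ)} ≤ δ)
    {S : Set Ω} (hS : MeasurableSet S) :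
    μ.tilted f S ≤ ENNReal.ofReal (Real.exp ε) * μ.tilted g S + δ := by
  let B : Set Ω := {x | ε < f x - g x + Real.log (∫ x, Real.exp (g x) ∂μ)
      - Real.log (∫ x, Real.exp (f x) ∂μ)}
  have hBm : MeasurableSet B := measurableSet_lt (by fun_prop) (by fun_prop)
  -- Off `B` the density ratio is at most `exp ε` pointwise.
  have h1 : μ.tilted f (S \ B) ≤ ENNReal.ofReal (Real.exp ε) * μ.tilted g (S \ B) := by
    rw [tilted_apply' _ _ (hS.diff hBm), tilted_apply' _ _ (hS.diff hBm),
      ← lintegral_const_mul _ (by fun_prop)]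
    refine setLIntegral_mono (by fun_prop) fun x hx => ?_
    rw [← ENNReal.ofReal_mul (Real.exp_pos _).le]
    refine ENNReal.ofReal_le_ofReal ?_
    have hx' : ¬ ε < _ := hx.2
    rw [not_lt] at hx'
    rw [← Real.exp_log hfi, ← Real.exp_log hgi, ← Real.exp_sub, ← Real.exp_sub, ← Real.exp_add]
    exact Real.exp_le_exp.2 (by linarith)
  calc μ.tilted f S ≤ μ.tilted f (S \ B) + μ.tilted f B := by
        refine (measure_mono ?_).trans (measure_union_le _ _)
        intro x hx
        by_cases h : x ∈ B
        · exact Or.inr h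
        · exact Or.inl ⟨hx, h⟩
    _ ≤ _ := add_le_add (h1.trans (mul_le_mul_right (measure_mono Set.sdiff_subset) _)) htail

lemma gaussianOf_le_of_tail {κ κ' : ℝ} (hκ : 0 < κ) (hκ' : 0 < κ') {T T' : V →L[ℝ] V}
    (hT : IsCoerciveSymm κ T) (hT' : IsCoerciveSymm κ' T') {m m' : V} {ε : ℝ} {δ : ℝ≥0∞}
    (htail : gaussianOf T m {θ | ε < -(1 / 2) * ⟪T (θ - m), θ - m⟫
      + 1 / 2 * ⟪T' (θ - m'), θ - m'⟫ + Real.log (gaussianMass T')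
      - Real.log (gaussianMass T)} ≤ δ) {S : Set V} (hS : MeasurableSet S) :
    gaussianOf T m S ≤ ENNReal.ofReal (Real.exp ε) * gaussianOf T' m' S + δ := by
  refine tilted_le_of_tail (by fun_prop) (by fun_prop) ?_ ?_ ?_ hS
  · rw [integral_exp_neg_quadratic_sub]; exact gaussianMass_pos hκ hT
  · rw [integral_exp_neg_quadratic_sub]; exact gaussianMass_pos hκ' hT'
  · rw [integral_exp_neg_quadratic_sub, integral_exp_neg_quadratic_sub]
    refine le_trans (measure_mono fun θ hθ => ?_) htail
    simp only [Set.mem_ofPred_eq] at hθ ⊢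
    linarith

/-- Both masses are compared with that of `T`: a rank one term lowers the mass, and that of `y` by a
factor of at most `exp (b / 2)`. -/
lemma log_gaussianMass_add_rankOneSq_le {κ b : ℝ} (hκ : 0 < κ) {T : V →L[ℝ] V}
    (hT : IsCoerciveSymm κ T) (x : V) {y : V} (hy : ‖y‖ ^ 2 ≤ b * κ) :
    Real.log (gaussianMass (T + rankOneSq x))
      ≤ b / 2 + Real.log (gaussianMass (T + rankOneSq y)) := by
  have hZ' := gaussianMass_pos hκ (hT.add_rankOneSq y)
  rw [← Real.log_exp (b / 2), ← Real.log_mul (Real.exp_pos _).ne' hZ'.ne']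
  exact Real.log_le_log (gaussianMass_pos hκ (hT.add_rankOneSq x))
    ((gaussianMass_add_rankOneSq_le hκ hT x).trans (gaussianMass_le_add_rankOneSq hκ hT hy))

/-- Off an event of probability at most `3 exp (-t² / 2)`, three linear functionals of a Gaussian
vector satisfy their one-sided tail bounds. -/
lemma gaussianOf_tail_union {κ a β t : ℝ} (hκ : 0 < κ) (ha : 0 ≤ a) (hβ : 0 ≤ β) (ht : 0 ≤ t)
    {T : V →L[ℝ] V} (hT : IsCoerciveSymm κ T) (m : V) {g x : V} (hg : ‖g‖ ^ 2 ≤ a ^ 2 * κ)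
    (hx : ‖x‖ ^ 2 ≤ β ^ 2 * κ) {B : Set V}
    (hB : ∀ θ, ⟪g, θ - m⟫ ≤ a * t → |⟪x, θ - m⟫| ≤ β * t → θ ∉ B) :
    gaussianOf T m B ≤ ENNReal.ofReal (3 * Real.exp (-t ^ 2 / 2)) := by
  have h1 := gaussianOf_tail hκ ha ht hT m hg
  have h2 := gaussianOf_tail hκ hβ ht hT m hx
  have h3 := gaussianOf_tail hκ hβ ht hT m (c := -x) (by rwa [norm_neg])
  have hsub : B ⊆ {θ | a * t < ⟪g, θ - m⟫} ∪ ({θ | β * t < ⟪x, θ - m⟫}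
      ∪ {θ | β * t < ⟪-x, θ - m⟫}) := by
    intro θ hθ
    by_contra hcon
    simp only [Set.mem_union, Set.mem_ofPred_eq, not_or, not_lt, inner_neg_left] at hcon
    exact hB θ hcon.1 (abs_le.2 ⟨by linarith [hcon.2.2], hcon.2.1⟩) hθ
  refine (measure_mono hsub).trans ((measure_union_le _ _).trans
    ((add_le_add h1 ((measure_union_le _ _).trans (add_le_add h2 h3))).trans (le_of_eq ?_)))
  rw [← ENNReal.ofReal_add (by positivity) (by positivity),
    ← ENNReal.ofReal_add (by positivity) (by positivity)]
  congr 1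
  ring

/-- Two Gaussians whose precision operators share the coercive part `S` and whose means are
related by `g` are close in both directions. -/
theorem gaussianOf_indistinguishable {κ a b t : ℝ} (hκ : 0 < κ) (ha : 0 ≤ a) (ht : 0 ≤ t)
    {S : V →L[ℝ] V} (hS : IsCoerciveSymm κ S) {x x' g m m' : V}
    (hx : ‖x‖ ^ 2 ≤ b * κ) (hx' : ‖x'‖ ^ 2 ≤ b * κ) (hg : ‖g‖ ^ 2 ≤ a ^ 2 * κ)
    (hm : (S + rankOneSq x') (m' - m) = g) {A : Set V} (hA : MeasurableSet A) :
    gaussianOf (S + rankOneSq x) m A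
        ≤ ENNReal.ofReal (Real.exp (a ^ 2 + a * t + b / 2 * (1 + (a + t) ^ 2)))
          * gaussianOf (S + rankOneSq x') m' A + ENNReal.ofReal (3 * Real.exp (-t ^ 2 / 2)) ∧
      gaussianOf (S + rankOneSq x') m' A
        ≤ ENNReal.ofReal (Real.exp (a ^ 2 + a * t + b / 2 * (1 + (a + t) ^ 2)))
          * gaussianOf (S + rankOneSq x) m A + ENNReal.ofReal (3 * Real.exp (-t ^ 2 / 2)) := by
  have hb : 0 ≤ b := nonneg_of_mul_nonneg_left ((sq_nonneg _).trans hx) hκ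
  have hT := hS.add_rankOneSq x
  have hT' := hS.add_rankOneSq x'
  have hbs : Real.sqrt b ^ 2 = b := Real.sq_sqrt hb
  have hbn := Real.sqrt_nonneg b
  have hat : 0 ≤ a * t := mul_nonneg ha ht
  obtain ⟨w, hw⟩ : ∃ w, w = m' - m := ⟨_, rfl⟩
  rw [← hw] at hm
  have hTw := hT'.inner_le hκ w
  rw [hm] at hTw
  have hgw : ⟪g, w⟫ ≤ a ^ 2 := hTw.1.trans (by rwa [div_le_iff₀ hκ])
  constructor
  -- Expanding around `m`, only `⟪x', u⟫² / 2` and `-⟪g, u⟫` are random with an unfavorable sign,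
  -- hence the tails of `-g` and `x'`.
  · refine gaussianOf_le_of_tail hκ hκ hT hT' (gaussianOf_tail_union (g := -g) (x := x') hκ ha
      (Real.sqrt_nonneg b) ht hT m (by rwa [norm_neg]) (by rwa [hbs]) ?_) hA
    intro θ h1 h2
    rw [Set.mem_ofPred_eq, not_lt]
    have hlog := log_gaussianMass_add_rankOneSq_le hκ hS x' hx
    have hθ : θ - m' = (θ - m) - w := by rw [hw]; abel
    rw [hθ]
    generalize θ - m = u at *
    have e1 : ⟪(S + rankOneSq x') (u - w), u - w⟫
        = ⟪S u, u⟫ + ⟪x', u⟫ ^ 2 - 2 * ⟪g, u⟫ + ⟪g, w⟫ := by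
      have e2 : ⟪(S + rankOneSq x') u, w⟫ = ⟪g, u⟫ := by
        rw [hT'.symm, hm, real_inner_comm]
      have e3 : ⟪(S + rankOneSq x') u, u⟫ = ⟪S u, u⟫ + ⟪x', u⟫ ^ 2 := by
        rw [add_apply, inner_add_left, inner_rankOneSq_self]
      rw [map_sub, inner_sub_left, inner_sub_right, inner_sub_right, hm, e2, e3]
      ring
    rw [e1, add_apply, inner_add_left, inner_rankOneSq_self]
    rw [inner_neg_left] at h1
    have h3 : ⟪x', u⟫ ^ 2 ≤ b * t ^ 2 := by
      rw [← hbs, ← mul_pow, ← sq_abs]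
      exact pow_le_pow_left₀ (abs_nonneg _) h2 2
    have h4 : b * t ^ 2 ≤ b * (a + t) ^ 2 :=
      mul_le_mul_of_nonneg_left (pow_le_pow_left₀ ht (by linarith) 2) hb
    linarith [sq_nonneg ⟪x, u⟫, sq_nonneg a]
  · refine gaussianOf_le_of_tail hκ hκ hT' hT (gaussianOf_tail_union (g := g) (x := x) hκ ha
      (Real.sqrt_nonneg b) ht hT' m' hg (by rwa [hbs]) ?_) hA
    intro θ h1 h2
    rw [Set.mem_ofPred_eq, not_lt]
    have hlog := log_gaussianMass_add_rankOneSq_le hκ hS x hx'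
    have hθ : θ - m = (θ - m') + w := by rw [hw]; abel
    rw [hθ]
    generalize θ - m' = v at *
    have e1 : ⟪(S + rankOneSq x) (v + w), v + w⟫
        = ⟪(S + rankOneSq x') v, v⟫ + 2 * ⟪g, v⟫ + ⟪g, w⟫
          + ⟪x, v + w⟫ ^ 2 - ⟪x', v + w⟫ ^ 2 := by
      have e2 : ⟪(S + rankOneSq x') v, w⟫ = ⟪g, v⟫ := by
        rw [hT'.symm, hm, real_inner_comm]
      have e3 : ⟪(S + rankOneSq x) (v + w), v + w⟫
          = ⟪(S + rankOneSq x') (v + w), v + w⟫ + ⟪x, v + w⟫ ^ 2 - ⟪x', v + w⟫ ^ 2 := by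
        rw [add_apply, inner_add_left, inner_rankOneSq_self,
          add_apply, inner_add_left, inner_rankOneSq_self]
        ring
      rw [e3, map_add, inner_add_left, inner_add_right, inner_add_right, hm, e2]
      ring
    rw [e1]
    -- In this direction the rank one term sees the shifted vector `v + w`; the shift turns `t` into
    -- `a + t` in the bound.
    have hxw : |⟪x, w⟫| ≤ Real.sqrt b * a := by
      refine abs_le_of_sq_le_sq ?_ (mul_nonneg hbn ha)
      have c1 : ⟪x, w⟫ ^ 2 ≤ ‖x‖ ^ 2 * ‖w‖ ^ 2 := by
        rw [← mul_pow, ← sq_abs]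
        exact pow_le_pow_left₀ (abs_nonneg _) (abs_real_inner_le_norm x w) 2
      have c2 : κ * ‖w‖ ^ 2 ≤ a ^ 2 := by
        have c3 : (κ * ‖w‖) ^ 2 ≤ ‖g‖ ^ 2 := pow_le_pow_left₀ (by positivity) hTw.2 2
        refine le_of_mul_le_mul_right ?_ hκ
        nlinarith
      rw [mul_pow, hbs]
      calc ⟪x, w⟫ ^ 2 ≤ ‖x‖ ^ 2 * ‖w‖ ^ 2 := c1
        _ ≤ b * κ * ‖w‖ ^ 2 := mul_le_mul_of_nonneg_right hx (sq_nonneg _)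
        _ = b * (κ * ‖w‖ ^ 2) := by ring
        _ ≤ b * a ^ 2 := mul_le_mul_of_nonneg_left c2 hb
    have h3 : ⟪x, v + w⟫ ^ 2 ≤ b * (a + t) ^ 2 := by
      have c4 : |⟪x, v + w⟫| ≤ Real.sqrt b * (a + t) := by
        rw [inner_add_right]
        exact (abs_add_le _ _).trans (by linarith)
      calc ⟪x, v + w⟫ ^ 2 = |⟪x, v + w⟫| ^ 2 := (sq_abs _).symm
        _ ≤ (Real.sqrt b * (a + t)) ^ 2 := pow_le_pow_left₀ (abs_nonneg _) c4 2
        _ = b * (a + t) ^ 2 := by rw [mul_pow, hbs]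
    linarith [sq_nonneg ⟪x', v + w⟫, sq_nonneg a]

end Gaussian

/-! ### The posterior as a Gaussian and its data-dependent privacy -/

section Posterior

open scoped RealInnerProductSpace

variable {d n : ℕ} {𝒳 : Set (EuclideanSpace ℝ (Fin d))} {𝒴 : Set ℝ}

/-- The covariate of the data point `j`. -/
abbrev covariate (z : Dataset 𝒳 𝒴 n) (j : Fin n) : EuclideanSpace ℝ (Fin d) := (z j).1

/-- The regularised Gram operator `lam I + ∑ j ∈ s, x_j x_jᵀ`. -/
def gramOp (lam : ℝ) (z : Dataset 𝒳 𝒴 n) (s : Finset (Fin n)) :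
    EuclideanSpace ℝ (Fin d) →L[ℝ] EuclideanSpace ℝ (Fin d) :=
  lam • ContinuousLinearMap.id ℝ _ + ∑ j ∈ s, rankOneSq (covariate z j)

lemma gramOp_apply (lam : ℝ) (z : Dataset 𝒳 𝒴 n) (s : Finset (Fin n))
    (u : EuclideanSpace ℝ (Fin d)) :
    gramOp lam z s u = lam • u + ∑ j ∈ s, ⟪covariate z j, u⟫ • covariate z j := by
  simp [gramOp]

lemma gramOp_symm (lam : ℝ) (z : Dataset 𝒳 𝒴 n) (s : Finset (Fin n))
    (u v : EuclideanSpace ℝ (Fin d)) : ⟪gramOp lam z s u, v⟫ = ⟪u, gramOp lam z s v⟫ := by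
  simp only [gramOp_apply, inner_add_left, inner_add_right, sum_inner, inner_sum,
    real_inner_smul_left, real_inner_smul_right]
  congr 1
  refine Finset.sum_congr rfl fun j _ => ?_
  rw [real_inner_comm u (covariate z j)]
  ring

lemma inner_gramOp_self (lam : ℝ) (z : Dataset 𝒳 𝒴 n) (s : Finset (Fin n))
    (u : EuclideanSpace ℝ (Fin d)) :
    ⟪gramOp lam z s u, u⟫ = lam * ‖u‖ ^ 2 + ∑ j ∈ s, ⟪covariate z j, u⟫ ^ 2 := by
  simp only [gramOp_apply, inner_add_left, sum_inner, real_inner_smul_left,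
    real_inner_self_eq_norm_sq, sq]

lemma gramOp_univ (lam : ℝ) (z : Dataset 𝒳 𝒴 n) (i : Fin n) :
    gramOp lam z Finset.univ
      = gramOp lam z (Finset.univ.erase i) + rankOneSq (covariate z i) := by
  rw [gramOp, gramOp, add_assoc, Finset.sum_erase_add _ _ (Finset.mem_univ i)]

lemma smul_rankOneSq {gam : ℝ} (hgam : 0 ≤ gam) (x : EuclideanSpace ℝ (Fin d)) :
    gam • rankOneSq x = rankOneSq (Real.sqrt gam • x) := by
  ext1 u
  rw [smul_apply, rankOneSq_apply, rankOneSq_apply, real_inner_smul_left, smul_smul, smul_smul,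
    mul_right_comm, Real.mul_self_sqrt hgam]

lemma design_mulVec (z : Dataset 𝒳 𝒴 n) (u : EuclideanSpace ℝ (Fin d)) (j : Fin n) :
    (design z *ᵥ u.ofLp) j = ⟪covariate z j, u⟫ := by
  rw [real_inner_comm]
  simp [design, Matrix.mulVec, dotProduct, PiLp.inner_apply, mul_comm]

lemma transpose_design_mulVec (z : Dataset 𝒳 𝒴 n) (v : Fin n → ℝ) :
    (design z)ᵀ *ᵥ v = (∑ j, v j • covariate z j).ofLp := by
  ext k
  simp [design, Matrix.mulVec, dotProduct, mul_comm]

lemma gramOp_univ_ofLp (lam : ℝ) (z : Dataset 𝒳 𝒴 n) (u : EuclideanSpace ℝ (Fin d)) :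
    (gramOp lam z Finset.univ u).ofLp
      = ((design z)ᵀ * design z + lam • (1 : Matrix (Fin d) (Fin d) ℝ)) *ᵥ u.ofLp := by
  rw [Matrix.add_mulVec, ← Matrix.mulVec_mulVec, transpose_design_mulVec, Matrix.smul_mulVec,
    Matrix.one_mulVec, gramOp_apply, add_comm]
  simp only [design_mulVec]
  rfl

/-- The normal equations; `lam > 0` makes the matrix positive definite, so its inverse is a genuine
one. -/
lemma gramOp_ridge {lam : ℝ} (hlam : 0 < lam) (z : Dataset 𝒳 𝒴 n) :
    gramOp lam z Finset.univ (ridge lam z) = ∑ j, ((z j).2 : ℝ) • covariate z j := by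
  have hpos : ((design z)ᵀ * design z + lam • (1 : Matrix (Fin d) (Fin d) ℝ)).PosDef := by
    have h1 : ((design z)ᵀ * design z).PosSemidef := by
      simpa using Matrix.posSemidef_conjTranspose_mul_self (design z)
    exact Matrix.PosDef.posSemidef_add h1 (Matrix.PosDef.one.smul hlam)
  refine WithLp.ofLp_injective 2 ?_
  rw [gramOp_univ_ofLp, ridge, Matrix.mulVec_mulVec, Matrix.mul_nonsing_inv, Matrix.one_mulVec,
    transpose_design_mulVec]
  · rfl
  · exact (Matrix.isUnit_iff_isUnit_det _).1 hpos.isUnit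

/-- The Rayleigh bound: the eigenvalues of `XᵀX - λ_min I` are those of `XᵀX` shifted, hence
nonnegative. -/
lemma lambdaMin_mul_le (z : Dataset 𝒳 𝒴 n) (u : EuclideanSpace ℝ (Fin d)) :
    lambdaMin z * ‖u‖ ^ 2 ≤ ∑ j, ⟪covariate z j, u⟫ ^ 2 := by
  set A := (design z)ᵀ * design z with hAdef
  have hA : A.IsHermitian := by
    simpa using (Matrix.posSemidef_conjTranspose_mul_self (design z)).isHermitian
  set c := lambdaMin z
  have hBh : (A - c • (1 : Matrix (Fin d) (Fin d) ℝ)).IsHermitian :=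
    hA.sub (by simp [Matrix.IsHermitian])
  have hB : (A - c • (1 : Matrix (Fin d) (Fin d) ℝ)).PosSemidef := by
    rw [hBh.posSemidef_iff_eigenvalues_nonneg]
    intro k
    have h1 := hBh.eigenvalues_mem_spectrum_real k
    have h2 : hBh.eigenvalues k + c ∈ spectrum ℝ A := by
      rw [spectrum.add_mem_iff, neg_add_eq_sub, Algebra.algebraMap_eq_smul_one]
      exact h1
    have h3 : c ≤ hBh.eigenvalues k + c :=
      csInf_le (Matrix.finite_real_spectrum).bddBelow h2
    simpa using h3
  have h := hB.dotProduct_mulVec_nonneg u.ofLp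
  have h5 : star u.ofLp ⬝ᵥ (A *ᵥ u.ofLp) = ∑ j, ⟪covariate z j, u⟫ ^ 2 := by
    rw [hAdef, ← Matrix.mulVec_mulVec, star_trivial, Matrix.dotProduct_mulVec,
      Matrix.vecMul_transpose]
    simp only [dotProduct, design_mulVec, sq]
  have h6 : star u.ofLp ⬝ᵥ u.ofLp = ‖u‖ ^ 2 := by
    rw [EuclideanSpace.real_norm_sq_eq]
    simp [dotProduct, sq]
  rw [Matrix.sub_mulVec, Matrix.smul_mulVec, Matrix.one_mulVec, dotProduct_sub, dotProduct_smul,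
    h5, h6, smul_eq_mul] at h
  linarith

lemma norm_le_radius {E : Type*} [SeminormedAddCommGroup E] {A : Set E}
    (hA : Bornology.IsBounded A) {x : E} (hx : x ∈ A) : ‖x‖ ≤ radius A := by
  obtain ⟨C, hC⟩ := hA.exists_norm_le
  refine le_csSup ⟨C, ?_⟩ ⟨x, hx, rfl⟩
  rintro _ ⟨y, hy, rfl⟩
  exact hC y hy

lemma radius_nonneg {E : Type*} [SeminormedAddCommGroup E] (A : Set E) : 0 ≤ radius A :=
  Real.sSup_nonneg (by rintro _ ⟨y, _, rfl⟩; exact norm_nonneg y)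

lemma localLipschitz_nonneg (lam : ℝ) (z : Dataset 𝒳 𝒴 n) : 0 ≤ localLipschitz lam z := by
  have h1 := radius_nonneg 𝒳
  have h2 := radius_nonneg 𝒴
  unfold localLipschitz
  positivity

/-- The Gram operator without the data point `i` is still coercive. -/
lemma isCoerciveSymm_gramOp_erase (h𝒳 : Bornology.IsBounded 𝒳) {lam gam : ℝ} (hgam : 0 ≤ gam)
    (z : Dataset 𝒳 𝒴 n) (i : Fin n) :
    IsCoerciveSymm (gam * (lam + max (lambdaMin z - radius 𝒳 ^ 2) 0))
      (gam • gramOp lam z (Finset.univ.erase i)) where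
  symm u v := by
    rw [smul_apply, smul_apply, real_inner_smul_left, real_inner_smul_right, gramOp_symm]
  bound u := by
    rw [smul_apply, real_inner_smul_left, inner_gramOp_self, mul_assoc]
    refine mul_le_mul_of_nonneg_left ?_ hgam
    rw [add_mul]
    refine add_le_add_right ?_ _
    rw [max_mul_of_nonneg _ _ (sq_nonneg _), zero_mul]
    refine max_le ?_ (Finset.sum_nonneg fun j _ => sq_nonneg _)
    have h1 := lambdaMin_mul_le z u
    rw [← Finset.sum_erase_add _ _ (Finset.mem_univ i)] at h1
    have h2 : ⟪covariate z i, u⟫ ^ 2 ≤ radius 𝒳 ^ 2 * ‖u‖ ^ 2 := by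
      rw [← mul_pow, ← sq_abs]
      exact pow_le_pow_left₀ (abs_nonneg _) ((abs_real_inner_le_norm _ _).trans
        (mul_le_mul_of_nonneg_right (norm_le_radius h𝒳 (z i).1.2) (norm_nonneg _))) 2
    linarith

lemma isCoerciveSymm_gramOp_univ {lam gam : ℝ} (hgam : 0 ≤ gam) (z : Dataset 𝒳 𝒴 n) :
    IsCoerciveSymm (gam * lam) (gam • gramOp lam z Finset.univ) where
  symm u v := by
    rw [smul_apply, smul_apply, real_inner_smul_left, real_inner_smul_right, gramOp_symm]
  bound u := by
    rw [smul_apply, real_inner_smul_left, inner_gramOp_self, mul_assoc]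
    refine mul_le_mul_of_nonneg_left ?_ hgam
    have : 0 ≤ ∑ j, ⟪covariate z j, u⟫ ^ 2 := Finset.sum_nonneg fun j _ => sq_nonneg _
    linarith

/-- Adding a constant to the exponent does not change a tilted measure. -/
lemma tilted_add_const {Ω : Type*} [MeasurableSpace Ω] {μ : Measure Ω} [NeZero μ] {f : Ω → ℝ}
    (hf : Integrable (fun x => Real.exp (f x)) μ) (c : ℝ) :
    μ.tilted (fun x => f x + c) = μ.tilted f := by
  have := isProbabilityMeasure_tilted hf
  have h := tilted_tilted hf (fun _ => c)
  rw [tilted_const] at h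
  exact h.symm

/-- The posterior is Gaussian, centred at the ridge solution. -/
lemma posterior_eq_gaussianOf {lam gam : ℝ} (hlam : 0 < lam) (hgam : 0 < gam)
    (z : Dataset 𝒳 𝒴 n) :
    posterior lam gam z = gaussianOf (gam • gramOp lam z Finset.univ) (ridge lam z) := by
  have hint := integrable_exp_neg_quadratic_sub (mul_pos hgam hlam)
    (isCoerciveSymm_gramOp_univ hgam.le z) (ridge lam z)
  -- The added constant is what completing the square leaves over; it does not depend on `θ`.
  rw [gaussianOf, ← tilted_add_const hint (-gam * ((1 / 2) * ∑ j, ((z j).2 : ℝ) ^ 2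
    - 1 / 2 * ⟪gramOp lam z Finset.univ (ridge lam z), ridge lam z⟫)), posterior]
  congr 1
  ext θ
  have h1 : loss z θ = (1 / 2) * ∑ j, ((z j).2 : ℝ) ^ 2
      - ⟪∑ j, ((z j).2 : ℝ) • covariate z j, θ⟫ + 1 / 2 * ∑ j, ⟪covariate z j, θ⟫ ^ 2 := by
    rw [loss, sum_inner, Finset.mul_sum, Finset.mul_sum, Finset.mul_sum,
      ← Finset.sum_sub_distrib, ← Finset.sum_add_distrib]
    refine Finset.sum_congr rfl fun j _ => ?_
    rw [design_mulVec, real_inner_smul_left, response]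
    ring
  have h2 := inner_gramOp_self lam z Finset.univ θ
  have h3 := gramOp_symm lam z Finset.univ θ (ridge lam z)
  rw [smul_apply, real_inner_smul_left, map_sub, inner_sub_left, inner_sub_right, inner_sub_right,
    h2, h3, real_inner_comm, gramOp_ridge hlam, h1]
  ring

lemma isProbabilityMeasure_posterior {lam gam : ℝ} (hlam : 0 < lam) (hgam : 0 < gam)
    (z : Dataset 𝒳 𝒴 n) : IsProbabilityMeasure (posterior lam gam z) := by
  rw [posterior_eq_gaussianOf hlam hgam]
  exact isProbabilityMeasure_gaussianOf (mul_pos hgam hlam)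
    (isCoerciveSymm_gramOp_univ hgam.le z) _

lemma Neighbor.exists_eq_of_ne {A : Type*} {z z' : Fin n → A} (h : Neighbor z z') (hne : z ≠ z') :
    ∃ i, ∀ j, j ≠ i → z j = z' j := by
  classical
  unfold Neighbor hammingDist at h
  obtain ⟨i, hi⟩ := Function.ne_iff.1 hne
  refine ⟨i, fun j hj => ?_⟩
  by_contra hcon
  refine hj (Finset.card_le_one.1 h j ?_ i ?_)
  · simpa using hcon
  · simpa using hi

/-- The vector is minus the gradient at `θ` of the one-point loss; this is where the form of
`localLipschitz` comes from. -/
lemma norm_residual_le (h𝒳 : Bornology.IsBounded 𝒳) (h𝒴 : Bornology.IsBounded 𝒴)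
    {x θ : EuclideanSpace ℝ (Fin d)} {y : ℝ} (hx : x ∈ 𝒳) (hy : y ∈ 𝒴) :
    ‖(y - ⟪x, θ⟫) • x‖ ≤ radius 𝒳 * (radius 𝒳 * ‖θ‖ + radius 𝒴) := by
  have h1 := norm_le_radius h𝒳 hx
  have h2 := norm_le_radius h𝒴 hy
  rw [norm_smul, mul_comm]
  refine mul_le_mul h1 ?_ (norm_nonneg _) (radius_nonneg _)
  refine (norm_sub_le _ _).trans ?_
  have h3 : ‖⟪x, θ⟫‖ ≤ radius 𝒳 * ‖θ‖ :=
    (norm_inner_le_norm x θ).trans (mul_le_mul_of_nonneg_right h1 (norm_nonneg _))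
  linarith

lemma explicitBound_nonneg {lam gam B δ l L : ℝ} (hlam : 0 < lam) (hL : 0 ≤ L) :
    0 ≤ explicitBound lam gam B δ l L := by
  have hκ : 0 < lam + max (l - B ^ 2) 0 := by positivity
  unfold explicitBound
  positivity

/-- The explicit bound is a data-dependent privacy guarantee of the posterior sampler. -/
theorem posterior_isDataDependentDP (h𝒳 : Bornology.IsBounded 𝒳) (h𝒴 : Bornology.IsBounded 𝒴)
    {lam gam δ : ℝ} (hlam : 0 < lam) (hgam : 0 < gam) (hδ : 0 < δ) (z : Dataset 𝒳 𝒴 n) :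
    IsDataDependentDP (posterior (𝒳 := 𝒳) (𝒴 := 𝒴) (n := n) lam gam) z
      (explicitBound lam gam (radius 𝒳) δ (lambdaMin z) (localLipschitz lam z)) δ := by
  intro z' hzz' A hA
  have hL := localLipschitz_nonneg lam z
  -- For `δ ≥ 1` the claim is trivial; otherwise `log (3 / δ) > 0`, so the square root in `t` is not
  -- truncated.
  by_cases hδ1 : 1 ≤ δ
  · have h1 : ∀ y : Dataset 𝒳 𝒴 n, posterior lam gam y A ≤ ENNReal.ofReal δ := fun y => by
      have := isProbabilityMeasure_posterior hlam hgam y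
      exact prob_le_one.trans (by simpa using hδ1)
    exact ⟨(h1 z).trans le_add_self, (h1 z').trans le_add_self⟩
  -- Equal data sets have no differing index to remove, and `n` may be `0`.
  by_cases hne : z = z'
  · subst hne
    have h1 : posterior lam gam z A ≤ ENNReal.ofReal (Real.exp (explicitBound lam gam (radius 𝒳) δ
        (lambdaMin z) (localLipschitz lam z))) * posterior lam gam z A := by
      refine le_mul_of_one_le_left (by simp) ?_
      simpa using explicitBound_nonneg hlam hL
    exact ⟨h1.trans le_self_add, h1.trans le_self_add⟩
  obtain ⟨i, hi⟩ := hzz'.exists_eq_of_ne hne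
  have hκ : 0 < lam + max (lambdaMin z - radius 𝒳 ^ 2) 0 := by positivity
  set κ := lam + max (lambdaMin z - radius 𝒳 ^ 2) 0
  set t := Real.sqrt (2 * Real.log (3 / δ)) with ht
  have hlog : 0 ≤ 2 * Real.log (3 / δ) := by
    have : 0 ≤ Real.log (3 / δ) := Real.log_nonneg (by rw [le_div_iff₀ hδ]; linarith)
    linarith
  have htail : 3 * Real.exp (-t ^ 2 / 2) = δ := by
    rw [ht, Real.sq_sqrt hlog, show -(2 * Real.log (3 / δ)) / 2 = -Real.log (3 / δ) by ring,
      Real.exp_neg, Real.exp_log (by positivity)]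
    field_simp
  have hsame : gramOp lam z' (Finset.univ.erase i) = gramOp lam z (Finset.univ.erase i) := by
    unfold gramOp
    congr 1
    refine Finset.sum_congr rfl fun j hj => ?_
    rw [covariate, covariate, hi j (Finset.ne_of_mem_erase hj)]
  have hprec : gam • gramOp lam z Finset.univ = gam • gramOp lam z (Finset.univ.erase i)
      + rankOneSq (Real.sqrt gam • covariate z i) := by
    rw [gramOp_univ lam z i, smul_add, smul_rankOneSq hgam.le]
  have hprec' : gam • gramOp lam z' Finset.univ = gam • gramOp lam z (Finset.univ.erase i)
      + rankOneSq (Real.sqrt gam • covariate z' i) := by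
    rw [gramOp_univ lam z' i, smul_add, smul_rankOneSq hgam.le, hsame]
  have hx : ∀ y : Dataset 𝒳 𝒴 n, ‖Real.sqrt gam • covariate y i‖ ^ 2
      ≤ radius 𝒳 ^ 2 / κ * (gam * κ) := fun y => by
    rw [norm_smul, mul_pow, Real.norm_eq_abs, sq_abs, Real.sq_sqrt hgam.le,
      show radius 𝒳 ^ 2 / κ * (gam * κ) = gam * radius 𝒳 ^ 2 by field_simp]
    exact mul_le_mul_of_nonneg_left
      (pow_le_pow_left₀ (norm_nonneg _) (norm_le_radius h𝒳 (y i).1.2) 2) hgam.le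
  set m := ridge lam z with hm
  set g := gam • ((((z' i).2 : ℝ) - ⟪covariate z' i, m⟫) • covariate z' i
    - (((z i).2 : ℝ) - ⟪covariate z i, m⟫) • covariate z i) with hgdef
  have hmean : (gam • gramOp lam z (Finset.univ.erase i)
      + rankOneSq (Real.sqrt gam • covariate z' i)) (ridge lam z' - m) = g := by
    have h1 := gramOp_ridge hlam z'
    have h2 := gramOp_ridge hlam z
    rw [← hprec', map_sub, smul_apply, smul_apply, h1, ← smul_sub, hgdef]
    congr 1
    rw [gramOp_univ lam z i] at h2
    rw [gramOp_univ lam z' i, hsame, add_apply, rankOneSq_apply]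
    rw [add_apply, rankOneSq_apply, ← hm] at h2
    rw [← Finset.sum_erase_add _ _ (Finset.mem_univ i)] at h2 ⊢
    have h3 : ∑ j ∈ Finset.univ.erase i, ((z' j).2 : ℝ) • covariate z' j
        = ∑ j ∈ Finset.univ.erase i, ((z j).2 : ℝ) • covariate z j :=
      Finset.sum_congr rfl fun j hj => by
        rw [covariate, covariate, hi j (Finset.ne_of_mem_erase hj)]
    rw [h3, ← sub_eq_iff_eq_add.2 h2.symm]
    simp only [sub_smul]
    abel
  have hg : ‖g‖ ^ 2 ≤ (2 * localLipschitz lam z * Real.sqrt (gam / κ)) ^ 2 * (gam * κ) := by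
    have h1 : ‖g‖ ≤ gam * (2 * localLipschitz lam z) := by
      rw [hgdef, norm_smul, Real.norm_of_nonneg hgam.le]
      refine mul_le_mul_of_nonneg_left ((norm_sub_le _ _).trans ?_) hgam.le
      have h2 := norm_residual_le h𝒳 h𝒴 (θ := m) (z' i).1.2 (z' i).2.2
      have h3 := norm_residual_le h𝒳 h𝒴 (θ := m) (z i).1.2 (z i).2.2
      unfold localLipschitz
      linarith
    refine (pow_le_pow_left₀ (norm_nonneg _) h1 2).trans (le_of_eq ?_)
    rw [mul_pow _ (Real.sqrt _), Real.sq_sqrt (by positivity)]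
    field_simp
  have hfin := gaussianOf_indistinguishable (mul_pos hgam hκ) (t := t)
    (mul_nonneg (by linarith) (Real.sqrt_nonneg (gam / κ))) (Real.sqrt_nonneg _)
    (isCoerciveSymm_gramOp_erase h𝒳 (lam := lam) hgam.le z i) (hx z) (hx z') hg hmean hA
  rw [htail, ← hprec, ← hprec', ← posterior_eq_gaussianOf hlam hgam,
    ← posterior_eq_gaussianOf hlam hgam] at hfin
  exact hfin

end Posterior

/-! ### Composition of approximate inequalities between measures -/

section Composition

/-- An approximate inequality between two measures extends from sets to functions with values in
`[0, 1]`. -/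
lemma lintegral_le_of_measure_le {Ω : Type*} [MeasurableSpace Ω] {μ ν : Measure Ω}
    {c δ : ℝ≥0∞} (h : ∀ S, MeasurableSet S → μ S ≤ c * ν S + δ)
    {f : Ω → ℝ≥0∞} (hf : Measurable f) (hf1 : ∀ x, f x ≤ 1) :
    ∫⁻ x, f x ∂μ ≤ c * ∫⁻ x, f x ∂ν + δ := by
  have hfin : ∀ x, f x ≠ ∞ := fun x => ((hf1 x).trans_lt ENNReal.one_lt_top).ne
  -- Layer cake over `(0, 1]`: the levels have total length one, so integrating the additive error
  -- costs exactly `δ`.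
  have layer : ∀ ρ : Measure Ω, ∫⁻ x, f x ∂ρ
      = ∫⁻ t in Set.Ioc (0 : ℝ) 1, ρ {x | t ≤ (f x).toReal} := by
    intro ρ
    have h1 := lintegral_eq_lintegral_meas_le ρ (f := fun x => (f x).toReal)
      (ae_of_all _ fun x => ENNReal.toReal_nonneg) hf.ennreal_toReal.aemeasurable
    simp only [ENNReal.ofReal_toReal (hfin _)] at h1
    rw [h1, ← Set.Ioc_union_Ioi_eq_Ioi zero_le_one, lintegral_union measurableSet_Ioi
      (Set.Ioc_disjoint_Ioi le_rfl)]
    have h2 : ∫⁻ t in Set.Ioi (1 : ℝ), ρ {x | t ≤ (f x).toReal} = 0 := by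
      rw [setLIntegral_congr_fun (g := fun _ => 0) measurableSet_Ioi, lintegral_zero]
      intro t ht
      have : {x | t ≤ (f x).toReal} = ∅ := by
        refine Set.eq_empty_of_forall_notMem fun x hx => ?_
        have h3 : (f x).toReal ≤ 1 := ENNReal.toReal_le_of_le_ofReal zero_le_one
          (by simpa using hf1 x)
        exact absurd (lt_of_lt_of_le ht (le_trans hx h3)) (lt_irrefl _)
      simp [this]
    rw [h2, add_zero]
  have hmeas : Measurable fun t : ℝ => ν {x | t ≤ (f x).toReal} :=
    Antitone.measurable fun s t hst => measure_mono fun x hx => le_trans hst hx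
  rw [layer μ, layer ν]
  calc ∫⁻ t in Set.Ioc (0 : ℝ) 1, μ {x | t ≤ (f x).toReal}
      ≤ ∫⁻ t in Set.Ioc (0 : ℝ) 1, (c * ν {x | t ≤ (f x).toReal} + δ) :=
        lintegral_mono fun t => h _ (measurableSet_le measurable_const hf.ennreal_toReal)
    _ = c * (∫⁻ t in Set.Ioc (0 : ℝ) 1, ν {x | t ≤ (f x).toReal}) + δ := by
        rw [lintegral_add_right _ measurable_const, lintegral_const_mul _ hmeas]
        simp

/-- Composition of an `(ε, δ)`-close pair of laws with kernels that are close on an event of high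
probability. -/
lemma bind_le_of_kernel_le {Ω Ω' : Type*} [MeasurableSpace Ω] [MeasurableSpace Ω']
    {μ ν : Measure Ω} [IsProbabilityMeasure μ] {K K' : Ω → Measure Ω'}
    (hK : Measurable K) (hK' : Measurable K') (hK1 : ∀ r, IsProbabilityMeasure (K r))
    {c c' δ δ' η : ℝ≥0∞} (hμν : ∀ S, MeasurableSet S → μ S ≤ c * ν S + δ)
    {E : Set Ω} (hE : MeasurableSet E) (hμE : μ Eᶜ ≤ η) {S : Set Ω'} (hS : MeasurableSet S)
    (hKK : ∀ r ∈ E, K r S ≤ c' * K' r S + δ') :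
    μ.bind K S ≤ c * c' * ν.bind K' S + (δ + η + δ') := by
  rw [Measure.bind_apply hS hK.aemeasurable, Measure.bind_apply hS hK'.aemeasurable]
  have hKS' : Measurable fun r => K' r S := (Measure.measurable_coe hS).comp hK'
  have hf : Measurable fun r => min 1 (c' * K' r S) := measurable_const.min (hKS'.const_mul _)
  -- Truncating at `1` keeps the integrand in `[0, 1]`, so passing from `μ` to `ν` adds only `δ`.
  have hpt : ∀ r, K r S ≤ min 1 (c' * K' r S) + (Eᶜ.indicator 1 r + δ') := by
    intro r
    have := hK1 r
    by_cases hr : r ∈ E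
    · rw [Set.indicator_of_notMem (by simpa using hr), zero_add]
      rcases le_total 1 (c' * K' r S) with h | h
      · rw [min_eq_left h]
        exact prob_le_one.trans le_self_add
      · rw [min_eq_right h]
        exact hKK r hr
    · rw [Set.indicator_of_mem (by simpa using hr), Pi.one_apply, ← add_assoc, add_right_comm]
      exact prob_le_one.trans le_add_self
  calc ∫⁻ r, K r S ∂μ
      ≤ ∫⁻ r, (min 1 (c' * K' r S) + (Eᶜ.indicator 1 r + δ')) ∂μ := lintegral_mono hpt
    _ = ∫⁻ r, min 1 (c' * K' r S) ∂μ + (μ Eᶜ + δ') := by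
        rw [lintegral_add_left hf, lintegral_add_right _ measurable_const,
          lintegral_indicator_one hE.compl]
        simp
    _ ≤ (c * ∫⁻ r, min 1 (c' * K' r S) ∂ν + δ) + (η + δ') :=
        add_le_add (lintegral_le_of_measure_le hμν hf fun r => min_le_left _ _)
          (add_le_add_left hμE _)
    _ ≤ (c * (c' * ∫⁻ r, K' r S ∂ν) + δ) + (η + δ') := by
        rw [← lintegral_const_mul _ hKS']
        gcongr
        exact min_le_right _ _
    _ = c * c' * ∫⁻ r, K' r S ∂ν + (δ + η + δ') := by ring

end Composition

/-! ### Privacy of propose-test-release -/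

section PTR

variable {d n : ℕ} {𝒳 : Set (EuclideanSpace ℝ (Fin d))} {𝒴 : Set ℝ}

open Classical in
/-- The law of the published output given the release `r`. -/
def ptrKernel (lam gam : ℝ) (epsP : ℝ × ℝ × ℝ → ℝ) (epsHat : ℝ) (z : Dataset 𝒳 𝒴 n)
    (r : ℝ × ℝ × ℝ) : Measure ((ℝ × ℝ × ℝ) × (EuclideanSpace ℝ (Fin d) ⊕ Unit)) :=
  if epsP r < epsHat then (posterior lam gam z).map fun θ => (r, Sum.inl θ)
  else Measure.dirac (r, Sum.inr ())

lemma measurable_release_inl (r : ℝ × ℝ × ℝ) :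
    Measurable fun θ : EuclideanSpace ℝ (Fin d) =>
      ((r, Sum.inl θ) : (ℝ × ℝ × ℝ) × (EuclideanSpace ℝ (Fin d) ⊕ Unit)) :=
  measurable_const.prodMk measurable_inl

lemma measurable_ptrKernel {lam gam : ℝ} (hlam : 0 < lam) (hgam : 0 < gam)
    {epsP : ℝ × ℝ × ℝ → ℝ} (hP : Measurable epsP) (epsHat : ℝ) (z : Dataset 𝒳 𝒴 n) :
    Measurable (ptrKernel lam gam epsP epsHat z) := by
  have := isProbabilityMeasure_posterior hlam hgam z
  refine Measurable.ite (measurableSet_lt hP measurable_const) ?_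
    (Measure.measurable_dirac.comp (measurable_id.prodMk measurable_const))
  have h1 : Measurable fun r : ℝ × ℝ × ℝ =>
      (posterior lam gam z).map (Prod.mk r) := Measurable.map_prodMk_left
  have h2 := (Measure.measurable_map
    (Prod.map id Sum.inl : (ℝ × ℝ × ℝ) × EuclideanSpace ℝ (Fin d) →
      (ℝ × ℝ × ℝ) × (EuclideanSpace ℝ (Fin d) ⊕ Unit))
    (measurable_id.prodMap measurable_inl)).comp h1
  convert h2 using 2 with r
  rw [Function.comp_apply, Measure.map_map (measurable_id.prodMap measurable_inl)
    measurable_prodMk_left]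
  rfl

lemma isProbabilityMeasure_ptrKernel {lam gam : ℝ} (hlam : 0 < lam) (hgam : 0 < gam)
    (epsP : ℝ × ℝ × ℝ → ℝ) (epsHat : ℝ) (z : Dataset 𝒳 𝒴 n) (r : ℝ × ℝ × ℝ) :
    IsProbabilityMeasure (ptrKernel lam gam epsP epsHat z r) := by
  have := isProbabilityMeasure_posterior hlam hgam z
  unfold ptrKernel
  split_ifs
  · exact Measure.isProbabilityMeasure_map (measurable_release_inl r).aemeasurable
  · infer_instance

/-- Both data sets take the branch dictated by `r`. If the test passes, `η ≤ epsP r < epsHat`; if it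
fails, both laws are the same point mass. -/
lemma ptrKernel_le {lam gam epsHat δ η : ℝ} (hεhat : 0 ≤ epsHat)
    {epsP : ℝ × ℝ × ℝ → ℝ} {z z' : Dataset 𝒳 𝒴 n} (hzz' : Neighbor z z')
    (hη : IsDataDependentDP (posterior (𝒳 := 𝒳) (𝒴 := 𝒴) (n := n) lam gam) z η δ)
    {r : ℝ × ℝ × ℝ} (hr : η ≤ epsP r)
    {S : Set ((ℝ × ℝ × ℝ) × (EuclideanSpace ℝ (Fin d) ⊕ Unit))} (hS : MeasurableSet S) :
    ptrKernel lam gam epsP epsHat z r S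
      ≤ ENNReal.ofReal (Real.exp epsHat) * ptrKernel lam gam epsP epsHat z' r S
        + ENNReal.ofReal δ := by
  unfold ptrKernel
  split_ifs with h
  · rw [Measure.map_apply (measurable_release_inl r) hS,
      Measure.map_apply (measurable_release_inl r) hS]
    refine ((hη z' hzz' _ (measurable_release_inl r hS)).1).trans ?_
    gcongr
    exact hr.trans h.le
  · exact (le_mul_of_one_le_left (by simp) (by simpa using hεhat)).trans le_self_add

/-- Generalized propose-test-release with an arbitrary data-dependent privacy bound `η`. -/
theorem opsPTR_isDP {lam gam : ℝ} (hlam : 0 < lam) (hgam : 0 < gam)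
    {ε δ εhat δhat : ℝ} (hδ : 0 ≤ δ) (hεhat : 0 ≤ εhat) (hδhat : 0 < δhat)
    {R : Dataset 𝒳 𝒴 n → Measure (ℝ × ℝ × ℝ)} (hR : IsDP R ε (δ / 2))
    {η : Dataset 𝒳 𝒴 n → ℝ}
    (hη : ∀ z, IsDataDependentDP (posterior (𝒳 := 𝒳) (𝒴 := 𝒴) (n := n) lam gam) z (η z) δhat)
    {epsP : ℝ × ℝ × ℝ → ℝ} (hP : Measurable epsP)
    (hconf : ∀ z, ENNReal.ofReal (1 - δ / 2) ≤ R z {r | η z ≤ epsP r}) :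
    IsDP (opsPTR lam gam R epsP εhat) (ε + εhat) (δ + δhat) where
  isProbabilityMeasure z := by
    have := hR.isProbabilityMeasure z
    have := isProbabilityMeasure_ptrKernel hlam hgam epsP εhat z
    have hK := measurable_ptrKernel hlam hgam hP εhat z
    constructor
    change (R z).bind (ptrKernel lam gam epsP εhat z) Set.univ = 1
    rw [Measure.bind_apply MeasurableSet.univ hK.aemeasurable]
    simp
  bound z z' hzz' S hS := by
    have := hR.isProbabilityMeasure z
    have hE : MeasurableSet {r | η z ≤ epsP r} := measurableSet_le measurable_const hP
    have hEc : R z {r | η z ≤ epsP r}ᶜ ≤ ENNReal.ofReal (δ / 2) := by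
      -- Subadditivity of `ENNReal.ofReal` also covers `δ > 2`, where `1 - δ / 2` is negative.
      rw [prob_compl_eq_one_sub hE, tsub_le_iff_right]
      calc (1 : ℝ≥0∞) = ENNReal.ofReal (δ / 2 + (1 - δ / 2)) := by simp
        _ ≤ ENNReal.ofReal (δ / 2) + ENNReal.ofReal (1 - δ / 2) := ENNReal.ofReal_add_le
        _ ≤ _ := add_le_add_right (hconf z) _
    have h := bind_le_of_kernel_le (measurable_ptrKernel hlam hgam hP εhat z)
      (measurable_ptrKernel hlam hgam hP εhat z')
      (isProbabilityMeasure_ptrKernel hlam hgam epsP εhat z) (hR.bound z z' hzz') hE hEc hS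
      fun r hr => ptrKernel_le hεhat hzz' (hη z) hr hS
    rw [← ENNReal.ofReal_mul (Real.exp_pos _).le, ← Real.exp_add,
      ← ENNReal.ofReal_add (by positivity) (by positivity), add_halves,
      ← ENNReal.ofReal_add hδ hδhat.le] at h
    exact h

/-- `κ` grows with `l`, while `a` and `b` decrease in `κ` and `a` grows with `L`. Confidence bounds
therefore only enlarge the privacy bound. -/
lemma explicitBound_mono {lam gam B δ l l' L L' : ℝ} (hlam : 0 < lam) (hgam : 0 < gam)
    (hl : l' ≤ l) (hL : 0 ≤ L) (hL' : L ≤ L') :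
    explicitBound lam gam B δ l L ≤ explicitBound lam gam B δ l' L' := by
  have hκ : 0 < lam + max (l' - B ^ 2) 0 := by positivity
  have h2L : 0 ≤ 2 * L' := by linarith
  unfold explicitBound
  dsimp only
  gcongr

lemma measurable_explicitBound (lam gam B δ : ℝ) {l L : ℝ × ℝ × ℝ → ℝ} (hl : Measurable l)
    (hL : Measurable L) : Measurable fun r => explicitBound lam gam B δ (l r) (L r) := by
  unfold explicitBound
  fun_prop

end PTR

end OPSPTR

end

theorem mainTheorem3 {d n : ℕ} (𝒳 : Set (EuclideanSpace ℝ (Fin d))) (𝒴 : Set ℝ)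
    (h𝒳 : Bornology.IsBounded 𝒳) (h𝒴 : Bornology.IsBounded 𝒴)
    (lam gam : ℝ) (hlam : 0 < lam) (hgam : 0 < gam)
    (ε δ εhat δhat : ℝ) (hε : 0 ≤ ε) (hδ : 0 ≤ δ) (hεhat : 0 ≤ εhat) (hδhat : 0 < δhat)
    (R : OPSPTR.Dataset 𝒳 𝒴 n → MeasureTheory.Measure (ℝ × ℝ × ℝ))
    (hR : OPSPTR.IsDP R ε (δ / 2)) :
    -- an arbitrary data-dependent privacy bound `e` of the posterior sampler, as a function of
    -- `λ_min`, `‖θ‖` and `L`, with a sanitized upper bound `epsP` computed from the release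
    (∀ e : ℝ → ℝ → ℝ → ℝ,
      (∀ z : OPSPTR.Dataset 𝒳 𝒴 n,
        OPSPTR.IsDataDependentDP (OPSPTR.posterior (𝒳 := 𝒳) (𝒴 := 𝒴) (n := n) lam gam) z
          (e (OPSPTR.lambdaMin z) ‖OPSPTR.ridge lam z‖ (OPSPTR.localLipschitz lam z)) δhat) →
      ∀ epsP : ℝ × ℝ × ℝ → ℝ, Measurable epsP →
      (∀ z : OPSPTR.Dataset 𝒳 𝒴 n,
        ENNReal.ofReal (1 - δ / 2) ≤
          R z {r | e (OPSPTR.lambdaMin z) ‖OPSPTR.ridge lam z‖ (OPSPTR.localLipschitz lam z)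
            ≤ epsP r}) →
      OPSPTR.IsDP (OPSPTR.opsPTR lam gam R epsP εhat) (ε + εhat) (δ + δhat)) ∧
    -- the explicit bound, evaluated at confidence bounds `conf r` for the three statistics
    (∀ conf : ℝ × ℝ × ℝ → ℝ × ℝ × ℝ, Measurable conf →
      (∀ z : OPSPTR.Dataset 𝒳 𝒴 n,
        ENNReal.ofReal (1 - δ / 2) ≤
          R z {r | (conf r).1 ≤ OPSPTR.lambdaMin z ∧ ‖OPSPTR.ridge lam z‖ ≤ (conf r).2.1 ∧
            OPSPTR.localLipschitz lam z ≤ (conf r).2.2}) →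
      OPSPTR.IsDP
        (OPSPTR.opsPTR lam gam R
          (fun r => OPSPTR.explicitBound lam gam (OPSPTR.radius 𝒳) δhat (conf r).1 (conf r).2.2)
          εhat)
        (ε + εhat) (δ + δhat)) := by
  constructor
  · intro e he epsP hP hconf
    exact OPSPTR.opsPTR_isDP hlam hgam hδ hεhat hδhat hR he hP hconf
  · intro conf hc hconf
    refine OPSPTR.opsPTR_isDP hlam hgam hδ hεhat hδhat hR
      (fun z => OPSPTR.posterior_isDataDependentDP h𝒳 h𝒴 hlam hgam hδhat z)
      (OPSPTR.measurable_explicitBound _ _ _ _ (by fun_prop) (by fun_prop)) fun z => ?_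
    -- When the confidence bounds hold, monotonicity makes the test value dominate the bound at the
    -- true statistics.
    refine (hconf z).trans (measure_mono fun r hr => ?_)
    exact OPSPTR.explicitBound_mono hlam hgam hr.1 (OPSPTR.localLipschitz_nonneg lam z) hr.2.2
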